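/- Notation. $B_n$ denotes the Bernoulli numbers, $z/(e^z-1)=\sum_{n\ge 0}B_n z^n/n!$, $\varphi$ is Euler's totient function, and $|\cdot|_p$ is the $p$-adic absolute value with $|p|_p=p^{-1}$. For a prime $p$ and $r\ge 1$ call $(p,l)$ an irregular pair of order $r$, written $(p,l)\in\Psi_r$, if $l$ is even, $2\le l<\varphi(p^r)$ and $p^r$ divides (the numerator of) $B_l/l$. For $(p,l)\in\Psi_1$ let $\Delta_{(p,l)}\in\{0,\dots,p-1\}$ be the residue $$\Delta_{(p,l)}\equiv p^{-1}\left(\frac{B_{l+p-1}}{l+p-1}-\frac{B_l}{l}\right)\pmod p .$$ It is called singular if $\Delta_{(p,l)}=0$. Theorem. Assume that no $\Delta_{(p,l)}$ with $(p,l)\in\Psi_1$ is singular. (a) For every $(p,l)\in\Psi_1$ there is exactly one sequence of digits $s_1,s_2,\dots\in\{0,\dots,p-1\}$ with $s_1=l$ such that $\bigl(p,\sum_{\nu=1}^{r}s_\nu\,\varphi(p^{\nu-1})\bigr)\in\Psi_r$ for all $r\ge1$. Put $$\chi_{(p,l)}=\sum_{\nu\ge 0}s_{\nu+2}\,p^\nu\in\mathbb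 Z_p .$$ There is a function $\zeta_{p,l}:\mathbb Z_p\to\mathbb Z_p$ (the $p$-adic zeta function attached to $(p,l)$) such that, for every $s\in\mathbb Z_p$, $$\zeta_{p,l}(s)=\lim_{t\to s}\,(1-p^{n_t-1})\left(-\frac{B_{n_t}}{n_t}\right),\qquad n_t=l+(p-1)t,$$ where $t$ runs through nonnegative integers converging $p$-adically to $s$; and $\chi_{(p,l)}$ is its unique zero. (b) For every even integer $n\ge 2$, $$B_n=(-1)^{\frac n2-1}\ \prod_{p-1\nmid n}|n|_p^{-1}\ \prod_{\substack{(p,l)\in\Psi_1\\ n\equiv l\ (\mathrm{mod}\ p-1)}}\left|\,p\left(\chi_{(p,l)}-\frac{n-l}{p-1}\right)\right|_p^{-1}\ \prod_{p-1\mid n}p^{-1},$$ where $p$ runs through the primes; the index sets of the second and third products are finite, and all but finitely many factors of the first product equal $1$. -/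

import Mathlib

open Filter Topology

instance factPrimeOfPrimes (p : Nat.Primes) : Fact (Nat.Prime (p : ℕ)) := ⟨p.2⟩

/-- `(p, l)` is an irregular pair of order `n`: `p` is prime, `l` is even, `2 ≤ l < φ(p ^ n)`, and
`p ^ n ∣ B_l / l`, i.e. `p ^ n` divides the numerator of `B_l / l` in lowest terms. -/
def IsIrregularPair (n p l : ℕ) : Prop :=
  p.Prime ∧ Even l ∧ 2 ≤ l ∧ l < (p ^ n).totient ∧ ((p ^ n : ℕ) : ℤ) ∣ (bernoulli l / l).num

/-- The set of irregular pairs (of order one) `(p, l)` with `l ≡ n` modulo `p - 1`. -/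
def irregularPairsAt (n : ℕ) : Set (Nat.Primes × ℕ) :=
  {x | IsIrregularPair 1 x.1 x.2 ∧ n ≡ x.2 [MOD (x.1 : ℕ) - 1]}

/-- `p ^ (-n) * (B_{l + φ(p ^ n)} / (l + φ(p ^ n)) - B_l / l)`. -/
def bernoulliDifferenceQuotient (n p l : ℕ) : ℚ :=
  (bernoulli (l + (p ^ n).totient) / ((l + (p ^ n).totient : ℕ) : ℚ) - bernoulli l / l)
    / (p : ℚ) ^ n

/-- `Δ_(p,l)` for an irregular pair `(p, l)` of order `n`: the least nonnegative residue modulo `p`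
of the (`p`-integral) rational number `bernoulliDifferenceQuotient n p l`,
computed as numerator times inverse denominator in `ZMod p`. -/
def irregularDelta (n p l : ℕ) : ℕ :=
  (((bernoulliDifferenceQuotient n p l).num : ZMod p) *
    ((bernoulliDifferenceQuotient n p l).den : ZMod p)⁻¹).val

/-- No `Δ_(p,l)`, for `(p, l)` an irregular pair of order one, is singular (that is, zero). -/
def DeltaConjecture : Prop :=
  ∀ p l : ℕ, IsIrregularPair 1 p l → irregularDelta 1 p l ≠ 0

/-- `(p, s 0, …, s (n - 1))` is the `p`-adic notation of an irregular pair of order `n`.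
The digits are indexed from `0`; in one-based numbering `s j` is the digit `s_{j+1}`. -/
def IsIrregularPairDigits (n p : ℕ) (s : ℕ → ℕ) : Prop :=
  Even (s 0) ∧ 2 ≤ s 0 ∧ s 0 + 3 ≤ p ∧ (∀ j < n, s j < p) ∧
    IsIrregularPair n p (∑ j ∈ Finset.range n, s j * (p ^ j).totient)

/-- `s` is an infinite digit sequence with `s 0 = l` all of whose truncations of length `n ≥ 1`
are irregular pairs of order `n`. -/
def IsIrregularDigitSequence (p l : ℕ) (s : ℕ → ℕ) : Prop :=
  s 0 = l ∧ ∀ n, 1 ≤ n → IsIrregularPairDigits n p s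

open Classical in
/-- The characteristic `p`-adic integer `χ_(p,l) = ∑_{ν ≥ 0} s (ν + 1) * p ^ ν`, where `s` is the
digit sequence of irregular pairs of higher order above `(p, l)` (and `0` if there is none). -/
noncomputable def irregularChi (p : ℕ) [Fact p.Prime] (l : ℕ) : ℤ_[p] :=
  if h : ∃ s, IsIrregularDigitSequence p l s then
    ∑' ν : ℕ, (h.choose (ν + 1) : ℤ_[p]) * (p : ℤ_[p]) ^ ν
  else 0

/-- `ζ_p(1 - n) = (1 - p ^ (n - 1)) ζ(1 - n) = (1 - p ^ (n - 1)) (- B_n / n)`, for `n ≥ 2`. -/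
def zetaWithoutEulerFactor (p n : ℕ) : ℚ :=
  (1 - (p : ℚ) ^ (n - 1)) * (-(bernoulli n / n))

/-- `ζ` is the `p`-adic zeta function `ζ_{p,l} : ℤ_p → ℤ_p`, i.e.
`ζ s = lim ζ_p(1 - (l + (p - 1) t))` as the nonnegative integer `t` tends `p`-adically to `s`
(`t = s` being allowed when `s` is itself a nonnegative integer). -/
def IsPadicZeta (p : ℕ) [Fact p.Prime] (l : ℕ) (ζ : ℤ_[p] → ℤ_[p]) : Prop :=
  ∀ s : ℤ_[p],
    Tendsto (fun t : ℕ => ((zetaWithoutEulerFactor p (l + (p - 1) * t) : ℚ) : ℚ_[p]))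
      (comap (fun t : ℕ => (t : ℤ_[p])) (𝓝 s)) (𝓝 (ζ s : ℚ_[p]))

/-! Fix an odd prime `p` and `l` with `p - 1 ∤ l`, and let `f t` be ζ_p(1 - n) at n = l + (p-1)t.
The key fact (`exists_hasKummerSlope_zetaWithoutEulerFactor`) is that `f` is `p`-integral and f(s) -
f(t) ≡ (s-t)(f(1)-f(0)) mod p²(s-t), with p ∣ f(1)-f(0). It comes from Voronoi's formula:
(cⁿ-1)B_n/n is a `p`-adic limit of sums of ⌊cj/p^M⌋(cj)^(n-1). Omitting the `j` divisible by `p`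
produces the Euler factor, and each remaining term is a constant times x^t with x ≡ 1 mod p. Such
first order expansions survive sums, products, inverses and limits.

If Δ is nonsingular, then |f(1)-f(0)| = 1/p exactly, so the linear term dominates and |f(s)-f(t)| =
|s-t|/p. For irregular `(p, l)`, f/p is thus an integral isometry; it has a zero χ and |f(t)| =
|p(χ-t)| (`exists_isZetaInterpolation`). Hence p^(n+1) divides B/(l+(p-1)t) iff t ≡ χ mod pⁿ: the
irregular pairs of higher order spell out the digits of χ.

The same equality gives the local factor of B_n at irregular pairs. At the other primes, von
Staudt–Clausen (p-1 ∣ n, which covers p = 2) or the Kummer congruences (B_n/n is a unit) apply. The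
product formula for ℚ gives |B_n|, and positivity of ζ(n) gives the sign. -/

/-- `g : ℕ → ℤ_[p]` satisfies `g s ≡ g t + (s - t) δ` modulo `p ^ 2 (s - t)`, with `p ∣ δ`. -/
def HasKummerSlope (p : ℕ) [Fact p.Prime] (g : ℕ → ℤ_[p]) (δ : ℤ_[p]) : Prop :=
  (p : ℤ_[p]) ∣ δ ∧
    ∀ s t : ℕ, (p : ℤ_[p]) ^ 2 * ((s : ℤ_[p]) - t) ∣ g s - g t - ((s : ℤ_[p]) - t) * δ

/-! ### Binomial congruences for powers of 1 + py. -/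

theorem PadicInt.dvd_iff_norm_le_norm {p : ℕ} [Fact p.Prime] {a x : ℤ_[p]} :
    a ∣ x ↔ ‖x‖ ≤ ‖a‖ := by
  constructor
  · rintro ⟨b, rfl⟩
    rw [norm_mul]
    exact mul_le_of_le_one_right (norm_nonneg _) b.norm_le_one
  · intro h
    by_cases ha : a = 0
    · subst ha
      rw [norm_zero] at h
      rw [norm_le_zero_iff.1 h]
    · have ha' : (a : ℚ_[p]) ≠ 0 := PadicInt.coe_ne_zero.2 ha
      have hq : ‖(x : ℚ_[p]) / a‖ ≤ 1 := by
        rw [norm_div]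
        exact div_le_one_of_le₀ h (norm_nonneg _)
      refine ⟨⟨(x : ℚ_[p]) / a, hq⟩, PadicInt.ext ?_⟩
      exact (mul_div_cancel₀ _ ha').symm

theorem one_add_pow_eq_add_cube_mul {R : Type*} [CommRing R] (a : R) (n : ℕ) :
    ∃ w, (1 + a) ^ n = 1 + n * a + (n.choose 2 : R) * a ^ 2 + a ^ 3 * w := by
  induction n with
  | zero => exact ⟨0, by simp⟩
  | succ n ih =>
    obtain ⟨w, hw⟩ := ih
    refine ⟨w * (1 + a) + (n.choose 2 : R), ?_⟩
    rw [pow_succ, hw, Nat.choose_succ_succ' n 1, Nat.choose_one_right]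
    push_cast
    ring

/-- Oddness enters here: p ∣ C(p,2) gives the quadratic term of each `p`-th power the extra factor
`p` it needs. -/
theorem one_add_prime_mul_pow_prime_pow {R : Type*} [CommRing R] {p : ℕ} (hp : p.Prime)
    (hp2 : p ≠ 2) (y : R) (j : ℕ) :
    ∃ z, (1 + (p : R) * y) ^ p ^ j = 1 + (p : R) ^ (j + 1) * (y + p * z) := by
  induction j with
  | zero => exact ⟨0, by simp⟩
  | succ j ih =>
    obtain ⟨z, hz⟩ := ih
    obtain ⟨w, hw⟩ := one_add_pow_eq_add_cube_mul ((p : R) ^ (j + 1) * (y + p * z)) p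
    obtain ⟨k, hk⟩ := hp.dvd_choose_self two_ne_zero (lt_of_le_of_ne hp.two_le hp2.symm)
    rw [pow_succ p j, pow_mul, hz, hw, hk]
    refine ⟨z + (p : R) ^ j * k * (y + p * z) ^ 2 + (p : R) ^ (2 * j) * (y + p * z) ^ 3 * w, ?_⟩
    push_cast
    ring

theorem PadicInt.sq_mul_dvd_one_add_pow_sub {p : ℕ} [hp : Fact p.Prime] (hp2 : p ≠ 2)
    (y : ℤ_[p]) (d : ℕ) :
    (p : ℤ_[p]) ^ 2 * d ∣ (1 + (p : ℤ_[p]) * y) ^ d - 1 - d * (p * y) := by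
  rcases eq_or_ne d 0 with rfl | hd
  · simp
  obtain ⟨j, m, hm, rfl⟩ := Nat.exists_eq_pow_mul_and_not_dvd hd p hp.out.ne_one
  obtain ⟨z, hz⟩ := one_add_prime_mul_pow_prime_pow hp.out hp2 y j
  obtain ⟨w, hw⟩ := one_add_pow_eq_add_cube_mul ((p : ℤ_[p]) ^ (j + 1) * (y + p * z)) m
  have hu : IsUnit (m : ℤ_[p]) := by
    rw [PadicInt.isUnit_iff, PadicInt.norm_natCast_eq_one_iff]
    exact (Nat.Prime.coprime_iff_not_dvd hp.out).2 hm
  obtain ⟨u, hu⟩ := hu.exists_right_inv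
  rw [pow_mul, hz, hw]
  -- The divisor is p^(j+2) m with `m` a unit, so the error terms lacking the factor `m` carry its
  -- inverse `u`.
  refine ⟨z + u * ((m.choose 2 : ℤ_[p]) * p ^ j * (y + p * z) ^ 2
    + p ^ (2 * j + 1) * (y + p * z) ^ 3 * w), ?_⟩
  push_cast
  linear_combination (-(p : ℤ_[p]) ^ (j + 2) * ((m.choose 2 : ℤ_[p]) * p ^ j * (y + p * z) ^ 2
    + p ^ (2 * j + 1) * (y + p * z) ^ 3 * w)) * hu

/-! ### Calculus of first order expansions modulo p²(s-t). -/

namespace HasKummerSlope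

variable {p : ℕ} [Fact p.Prime] {g h : ℕ → ℤ_[p]} {δ ε : ℤ_[p]}

theorem dvd_sub (hg : HasKummerSlope p g δ) (s t : ℕ) :
    (p : ℤ_[p]) * ((s : ℤ_[p]) - t) ∣ g s - g t := by
  obtain ⟨⟨a, ha⟩, h2⟩ := hg
  obtain ⟨b, hb⟩ := h2 s t
  exact ⟨p * b + a, by linear_combination hb + ((s : ℤ_[p]) - t) * ha⟩

theorem congr_slope (hg : HasKummerSlope p g δ) (hε : (p : ℤ_[p]) ^ 2 ∣ δ - ε) :
    HasKummerSlope p g ε := by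
  obtain ⟨⟨a, ha⟩, h2⟩ := hg
  obtain ⟨e, he⟩ := hε
  refine ⟨⟨a - p * e, by linear_combination ha - he⟩, fun s t => ?_⟩
  obtain ⟨b, hb⟩ := h2 s t
  exact ⟨b + e, by linear_combination hb + ((s : ℤ_[p]) - t) * he⟩

/-- A slope matters only modulo p², so it can be read off from two values; this makes it pass to
limits. -/
theorem sub_values (hg : HasKummerSlope p g δ) : HasKummerSlope p g (g 1 - g 0) := by
  refine hg.congr_slope ?_
  have := hg.2 1 0
  rw [← dvd_neg]
  simpa using this

theorem const (a : ℤ_[p]) : HasKummerSlope p (fun _ => a) 0 := ⟨by simp, by simp⟩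

theorem add (hg : HasKummerSlope p g δ) (hh : HasKummerSlope p h ε) :
    HasKummerSlope p (fun t => g t + h t) (δ + ε) := by
  refine ⟨dvd_add hg.1 hh.1, fun s t => ?_⟩
  obtain ⟨a, ha⟩ := hg.2 s t
  obtain ⟨b, hb⟩ := hh.2 s t
  exact ⟨a + b, by linear_combination ha + hb⟩

/-- Product rule. Freezing the factors at 0 changes them by multiples of `p`, and the slopes are
divisible by `p`, so the cost is absorbed by p². -/
theorem mul (hg : HasKummerSlope p g δ) (hh : HasKummerSlope p h ε) :
    HasKummerSlope p (fun t => g t * h t) (g 0 * ε + h 0 * δ) := by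
  refine ⟨dvd_add (hh.1.mul_left _) (hg.1.mul_left _), fun s t => ?_⟩
  obtain ⟨a, ha⟩ := hg.2 s t
  obtain ⟨b, hb⟩ := hh.2 s t
  obtain ⟨a', ha'⟩ := hg.dvd_sub s 0
  obtain ⟨b', hb'⟩ := hh.dvd_sub t 0
  obtain ⟨d, hd⟩ := hg.1
  obtain ⟨e, he⟩ := hh.1
  simp only [Nat.cast_zero, sub_zero] at ha' hb'
  refine ⟨g s * b + h t * a + s * a' * e + t * b' * d, ?_⟩
  linear_combination g s * hb + h t * ha + ((s : ℤ_[p]) - t) * ε * ha' +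
    ((s : ℤ_[p]) - t) * δ * hb' + ((s : ℤ_[p]) - t) * p * s * a' * he +
    ((s : ℤ_[p]) - t) * p * t * b' * hd

theorem const_mul (a : ℤ_[p]) (hg : HasKummerSlope p g δ) :
    HasKummerSlope p (fun t => a * g t) (a * δ) := by
  simpa using (const a).mul hg

theorem sum {ι : Type*} (S : Finset ι) {G : ι → ℕ → ℤ_[p]} {D : ι → ℤ_[p]}
    (hG : ∀ i ∈ S, HasKummerSlope p (G i) (D i)) :
    HasKummerSlope p (fun t => ∑ i ∈ S, G i t) (∑ i ∈ S, D i) := by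
  classical
  induction S using Finset.induction_on with
  | empty => simpa using const (p := p) 0
  | insert i S hi ih =>
    simp only [Finset.sum_insert hi]
    exact (hG i (Finset.mem_insert_self _ _)).add
      (ih fun j hj => hG j (Finset.mem_insert_of_mem hj))

theorem of_mul_eq_one (hg : HasKummerSlope p g δ) (hh : ∀ t, g t * h t = 1) :
    HasKummerSlope p h (-(h 0 ^ 2 * δ)) := by
  refine ⟨(hg.1.mul_left _).neg_right, fun s t => ?_⟩
  obtain ⟨a, ha⟩ := hg.2 s t
  obtain ⟨b, hb⟩ := hg.dvd_sub s 0
  obtain ⟨c, hc⟩ := hg.dvd_sub t 0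
  obtain ⟨d, hd⟩ := hg.1
  simp only [Nat.cast_zero, sub_zero] at hb hc
  have hst : h s - h t = -(h s * h t) * (g s - g t) := by
    linear_combination h t * hh s - h s * hh t
  have hs : h s - h 0 = -(h s * h 0) * (p * s * b) := by
    linear_combination h 0 * hh s - h s * hh 0 - h s * h 0 * hb
  have ht : h t - h 0 = -(h t * h 0) * (p * t * c) := by
    linear_combination h 0 * hh t - h t * hh 0 - h t * h 0 * hc
  refine ⟨-(h s * h t) * a + d * (h s * h 0 * s * b * h t + h 0 * (h t * h 0) * t * c), ?_⟩
  linear_combination hst - h s * h t * ha - ((s : ℤ_[p]) - t) * δ * (h t * hs + h 0 * ht)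
    + ((s : ℤ_[p]) - t) * p *
      (h s * h 0 * s * b * h t + h 0 * (h t * h 0) * t * c) * hd

/-- The slopes `D M` need not converge, but the differences G M 1 - G M 0 do; divisibility is a
closed condition on norms. -/
theorem of_tendsto {G : ℕ → ℕ → ℤ_[p]} {D : ℕ → ℤ_[p]}
    (hG : ∀ M, HasKummerSlope p (G M) (D M))
    (hlim : ∀ t, Tendsto (fun M => G M t) atTop (𝓝 (g t))) :
    HasKummerSlope p g (g 1 - g 0) := by
  have hD : Tendsto (fun M => G M 1 - G M 0) atTop (𝓝 (g 1 - g 0)) := (hlim 1).sub (hlim 0)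
  refine ⟨?_, fun s t => ?_⟩
  · rw [PadicInt.dvd_iff_norm_le_norm]
    exact le_of_tendsto' hD.norm fun M =>
      PadicInt.dvd_iff_norm_le_norm.1 (hG M).sub_values.1
  · rw [PadicInt.dvd_iff_norm_le_norm]
    exact le_of_tendsto' (((hlim s).sub (hlim t)).sub (hD.const_mul _)).norm fun M =>
      PadicInt.dvd_iff_norm_le_norm.1 ((hG M).sub_values.2 s t)

theorem pow (hp2 : p ≠ 2) {x : ℤ_[p]} (hx : (p : ℤ_[p]) ∣ x - 1) :
    HasKummerSlope p (fun t => x ^ t) (x - 1) := by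
  refine ⟨hx, ?_⟩
  obtain ⟨y, hy⟩ := hx
  obtain rfl : x = 1 + p * y := by linear_combination hy
  have key (t d : ℕ) : (p : ℤ_[p]) ^ 2 * d ∣
      (1 + (p : ℤ_[p]) * y) ^ (t + d) - (1 + (p : ℤ_[p]) * y) ^ t - d * (p * y) := by
    obtain ⟨a, ha⟩ := PadicInt.sq_mul_dvd_one_add_pow_sub hp2 y d
    obtain ⟨b, hb⟩ : (p : ℤ_[p]) ∣ (1 + (p : ℤ_[p]) * y) ^ t - 1 ^ t :=
      (Dvd.intro y (by ring)).trans (sub_dvd_pow_sub_pow _ _ t)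
    rw [one_pow] at hb
    refine ⟨(1 + (p : ℤ_[p]) * y) ^ t * a + y * b, ?_⟩
    linear_combination (1 + (p : ℤ_[p]) * y) ^ t * ha + d * p * y * hb
  intro s t
  rcases le_total t s with hst | hst
  · obtain ⟨d, rfl⟩ := Nat.exists_eq_add_of_le hst
    convert key t d using 1 <;> push_cast <;> ring
  · obtain ⟨d, rfl⟩ := Nat.exists_eq_add_of_le hst
    rw [← neg_dvd, ← dvd_neg]
    convert key s d using 1 <;> push_cast <;> ring

end HasKummerSlope

/-! ### Bernoulli numbers as `p`-adic limits: power sums and Voronoi's formula. -/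

theorem Padic.tendsto_natCast_prime_pow {p : ℕ} [Fact p.Prime] :
    Tendsto (fun M : ℕ => ((p ^ M : ℕ) : ℚ_[p])) atTop (𝓝 0) := by
  simpa using tendsto_pow_atTop_nhds_zero_of_norm_lt_one (Padic.norm_p_lt_one (p := p))

/-- In Faulhaber's formula divided by p^M, every term except that of B_n keeps a positive power of
p^M. -/
theorem Padic.tendsto_sum_pow_div_prime_pow (p : ℕ) [hp : Fact p.Prime] (n : ℕ) :
    Tendsto (fun M : ℕ => (∑ j ∈ Finset.range (p ^ M), (j : ℚ_[p]) ^ n) / ((p ^ M : ℕ) : ℚ_[p]))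
      atTop (𝓝 ((bernoulli n : ℚ) : ℚ_[p])) := by
  have hsum (M : ℕ) : (∑ j ∈ Finset.range (p ^ M), (j : ℚ_[p]) ^ n) / ((p ^ M : ℕ) : ℚ_[p]) =
      ∑ i ∈ Finset.range n, ((bernoulli i : ℚ) : ℚ_[p]) * ((n + 1).choose i : ℚ_[p]) / (n + 1) *
        ((p ^ M : ℕ) : ℚ_[p]) ^ (n - i) + ((bernoulli n : ℚ) : ℚ_[p]) := by
    have h := congrArg (fun q : ℚ => (q : ℚ_[p])) (sum_range_pow (p ^ M) n)
    have hM : ((p ^ M : ℕ) : ℚ_[p]) ≠ 0 := by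
      exact_mod_cast (pow_pos hp.out.pos M).ne'
    have hn : (n : ℚ_[p]) + 1 ≠ 0 := by exact_mod_cast n.succ_ne_zero
    simp only [Rat.cast_sum, Rat.cast_mul, Rat.cast_div, Rat.cast_pow, Rat.cast_natCast,
      Rat.cast_add, Rat.cast_one] at h
    rw [h, Finset.sum_range_succ, add_div, Finset.sum_div]
    congr 1
    · refine Finset.sum_congr rfl fun i hi => ?_
      have : n + 1 - i = n - i + 1 := by have := Finset.mem_range.1 hi; omega
      rw [this, pow_succ]
      field_simp
    · rw [Nat.choose_succ_self_right]
      simp only [Nat.add_sub_cancel_left, pow_one]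
      push_cast at hM ⊢
      field_simp
  simp_rw [hsum]
  have : Tendsto (fun M : ℕ => ∑ i ∈ Finset.range n,
      ((bernoulli i : ℚ) : ℚ_[p]) * ((n + 1).choose i : ℚ_[p]) / (n + 1) *
        ((p ^ M : ℕ) : ℚ_[p]) ^ (n - i)) atTop (𝓝 (∑ i ∈ Finset.range n, 0)) := by
    refine tendsto_finsetSum _ fun i hi => ?_
    have h0 : n - i ≠ 0 := by have := Finset.mem_range.1 hi; omega
    simpa [h0] using
      (Padic.tendsto_natCast_prime_pow.pow (n - i)).const_mul
        (((bernoulli i : ℚ) : ℚ_[p]) * ((n + 1).choose i : ℚ_[p]) / (n + 1))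
  simpa using this.add_const ((bernoulli n : ℚ) : ℚ_[p])

theorem Nat.sum_range_mul_mod {A : Type*} [AddCommMonoid A] {c m : ℕ} (hc : c.Coprime m)
    (F : ℕ → A) : ∑ j ∈ Finset.range m, F (c * j % m) = ∑ j ∈ Finset.range m, F j := by
  have hmaps : Set.MapsTo (fun j => c * j % m) (Finset.range m : Set ℕ) (Finset.range m) := by
    intro j hj
    have : j < m := by simpa using hj
    simpa using Nat.mod_lt _ (by omega)
  have hinj : Set.InjOn (fun j => c * j % m) (Finset.range m : Set ℕ) := by
    intro i hi j hj hij
    have h : i ≡ j [MOD m] := Nat.ModEq.cancel_left_of_coprime hc.symm hij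
    exact Nat.ModEq.eq_of_lt_of_lt h (by simpa using hi) (by simpa using hj)
  refine Finset.sum_bij (fun j _ => c * j % m) (fun j hj => hmaps hj)
    (fun i hi j hj hij => hinj hi hj hij) (fun b hb => ?_) (fun _ _ => rfl)
  obtain ⟨a, ha, hab⟩ := Finset.surj_on_of_inj_on_of_card_le (fun j _ => c * j % m)
    (fun j hj => hmaps hj) (fun i j hi hj hij => hinj hi hj hij) le_rfl b hb
  exact ⟨a, ha, hab.symm⟩

theorem sub_pow_eq_add_sq_mul (a b : ℤ) (n : ℕ) :
    ∃ w, (a - b) ^ n = a ^ n - n * a ^ (n - 1) * b + b ^ 2 * w := by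
  rcases n with _ | n
  · exact ⟨0, by simp⟩
  induction n with
  | zero => exact ⟨0, by simp⟩
  | succ n ih =>
    obtain ⟨w, hw⟩ := ih
    simp only [Nat.add_sub_cancel] at hw ⊢
    refine ⟨w * (a - b) + (n + 1) * a ^ n, ?_⟩
    rw [pow_succ, hw]
    push_cast
    ring

/-- Voronoi's sum `∑_{j < m} ⌊c j / m⌋ (c j) ^ (n - 1)`. -/
def voronoiSum (c n m : ℕ) : ℕ := ∑ j ∈ Finset.range m, c * j / m * (c * j) ^ (n - 1)

/-- Expand the `n`-th power of cj mod m = cj - m⌊cj/m⌋ modulo m² and sum over `j`: multiplication by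
`c` permutes the residues. -/
theorem exists_sum_pow_eq_voronoiSum {c m : ℕ} (hc : c.Coprime m) (n : ℕ) :
    ∃ E : ℤ, ((c : ℤ) ^ n - 1) * ∑ j ∈ Finset.range m, (j : ℤ) ^ n =
      n * m * voronoiSum c n m - m ^ 2 * E := by
  have h (j : ℕ) : ∃ w : ℤ, ((c * j % m : ℕ) : ℤ) ^ n =
      (c * j : ℤ) ^ n - n * (c * j : ℤ) ^ (n - 1) * (m * (c * j / m : ℕ)) + (m : ℤ) ^ 2 * w := by
    obtain ⟨w, hw⟩ := sub_pow_eq_add_sq_mul (c * j : ℤ) (m * (c * j / m : ℕ)) n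
    have hj : ((c * j % m : ℕ) : ℤ) = (c * j : ℤ) - m * (c * j / m : ℕ) := by
      have := Nat.mod_add_div (c * j) m
      rw [eq_sub_iff_add_eq]
      exact_mod_cast this
    exact ⟨(c * j / m : ℕ) ^ 2 * w, by rw [hj, hw]; ring⟩
  choose w hw using h
  refine ⟨∑ j ∈ Finset.range m, w j, ?_⟩
  have h1 := Nat.sum_range_mul_mod hc (fun j => (j : ℤ) ^ n)
  simp only [hw, Finset.sum_add_distrib, Finset.sum_sub_distrib] at h1
  have h2 : ∑ j ∈ Finset.range m, (c * j : ℤ) ^ n = c ^ n * ∑ j ∈ Finset.range m, (j : ℤ) ^ n := by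
    simp only [mul_pow, Finset.mul_sum]
  have h3 : ∑ j ∈ Finset.range m, (n : ℤ) * (c * j : ℤ) ^ (n - 1) * (m * (c * j / m : ℕ)) =
      n * m * voronoiSum c n m := by
    rw [voronoiSum, Nat.cast_sum, Finset.mul_sum]
    refine Finset.sum_congr rfl fun _ _ => ?_
    push_cast
    ring
  rw [h2, h3, ← Finset.mul_sum] at h1
  linear_combination h1

theorem Padic.tendsto_voronoiSum {p : ℕ} [hp : Fact p.Prime] {c : ℕ} (hc : c.Coprime p) {n : ℕ}
    (hn : n ≠ 0) :
    Tendsto (fun M : ℕ => (voronoiSum c n (p ^ M) : ℚ_[p])) atTop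
      (𝓝 (((c : ℚ_[p]) ^ n - 1) * ((bernoulli n : ℚ) : ℚ_[p]) / n)) := by
  have h (M : ℕ) := exists_sum_pow_eq_voronoiSum (hc.pow_right M) n
  choose E hE using h
  have hn' : (n : ℚ_[p]) ≠ 0 := by exact_mod_cast hn
  have hV (M : ℕ) : (voronoiSum c n (p ^ M) : ℚ_[p]) =
      ((c : ℚ_[p]) ^ n - 1) * ((∑ j ∈ Finset.range (p ^ M), (j : ℚ_[p]) ^ n) /
        ((p ^ M : ℕ) : ℚ_[p])) / n + ((p ^ M : ℕ) : ℚ_[p]) * (E M : ℚ_[p]) / n := by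
    have hM : ((p ^ M : ℕ) : ℚ_[p]) ≠ 0 := by exact_mod_cast (pow_pos hp.out.pos M).ne'
    have h := congrArg (fun z : ℤ => (z : ℚ_[p])) (hE M)
    push_cast at h hM ⊢
    field_simp
    linear_combination -h
  simp_rw [hV]
  have h0 : Tendsto (fun M => ((p ^ M : ℕ) : ℚ_[p]) * (E M : ℚ_[p]) / n) atTop (𝓝 0) := by
    have : Tendsto (fun M => ((p ^ M : ℕ) : ℚ_[p]) * (E M : ℚ_[p])) atTop (𝓝 0) := by
      refine squeeze_zero_norm (fun M => ?_)
        (tendsto_zero_iff_norm_tendsto_zero.1 (Padic.tendsto_natCast_prime_pow (p := p)))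
      rw [norm_mul]
      exact mul_le_of_le_one_right (norm_nonneg _) (Padic.norm_int_le_one _)
    simpa using this.div_const (n : ℚ_[p])
  simpa using (((Padic.tendsto_sum_pow_div_prime_pow p n).const_mul
    ((c : ℚ_[p]) ^ n - 1)).div_const (n : ℚ_[p])).add h0

/-- Source of the Euler factor: the terms j = pi reproduce the sum for `m`, scaled by p^(n-1). -/
theorem voronoiSum_prime_mul {p : ℕ} (hp : p.Prime) (c n m : ℕ) :
    voronoiSum c n (p * m) =
      ∑ j ∈ Finset.range (p * m) with ¬ p ∣ j, c * j / (p * m) * (c * j) ^ (n - 1) +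
        p ^ (n - 1) * voronoiSum c n m := by
  rw [voronoiSum, ← Finset.sum_filter_add_sum_filter_not _ (fun j => p ∣ j), add_comm]
  congr 1
  rw [voronoiSum, Finset.mul_sum]
  symm
  refine Finset.sum_bij (fun i _ => p * i) ?_ ?_ ?_ ?_
  · intro i hi
    simp only [Finset.mem_filter, Finset.mem_range, dvd_mul_right, and_true] at hi ⊢
    exact Nat.mul_lt_mul_of_pos_left hi hp.pos
  · intro i _ j _ hij
    exact Nat.eq_of_mul_eq_mul_left hp.pos hij
  · intro j hj
    simp only [Finset.mem_filter, Finset.mem_range] at hj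
    obtain ⟨hj, i, rfl⟩ := hj
    exact ⟨i, Finset.mem_range.2 (Nat.lt_of_mul_lt_mul_left hj), rfl⟩
  · intro i _
    rw [show c * (p * i) = p * (c * i) by ring, Nat.mul_div_mul_left _ _ hp.pos, mul_pow]
    ring

/-- Voronoi's sum restricted to the `j` prime to `p`. -/
def voronoiSumCoprime (p c n m : ℕ) : ℕ :=
  ∑ j ∈ Finset.range m with ¬ p ∣ j, c * j / m * (c * j) ^ (n - 1)

theorem Padic.tendsto_voronoiSumCoprime {p : ℕ} [hp : Fact p.Prime] {c : ℕ} (hc : c.Coprime p)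
    {n : ℕ} (hn : n ≠ 0) :
    Tendsto (fun M : ℕ => (voronoiSumCoprime p c n (p ^ (M + 1)) : ℚ_[p])) atTop
      (𝓝 (-((c : ℚ_[p]) ^ n - 1) * ((zetaWithoutEulerFactor p n : ℚ) : ℚ_[p]))) := by
  have h (M : ℕ) : (voronoiSumCoprime p c n (p ^ (M + 1)) : ℚ_[p]) =
      voronoiSum c n (p ^ (M + 1)) - (p : ℚ_[p]) ^ (n - 1) * voronoiSum c n (p ^ M) := by
    have := voronoiSum_prime_mul hp.out c n (p ^ M)
    rw [pow_succ', this, voronoiSumCoprime]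
    push_cast
    ring
  simp_rw [h]
  have hV := Padic.tendsto_voronoiSum hc hn
  have hz : -((c : ℚ_[p]) ^ n - 1) * ((zetaWithoutEulerFactor p n : ℚ) : ℚ_[p]) =
      ((c : ℚ_[p]) ^ n - 1) * ((bernoulli n : ℚ) : ℚ_[p]) / n -
        (p : ℚ_[p]) ^ (n - 1) * (((c : ℚ_[p]) ^ n - 1) * ((bernoulli n : ℚ) : ℚ_[p]) / n) := by
    simp only [zetaWithoutEulerFactor]
    push_cast
    ring
  rw [hz]
  exact (hV.comp (tendsto_add_atTop_nat 1)).sub (hV.const_mul ((p : ℚ_[p]) ^ (n - 1)))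

/-! ### Kummer congruences for the zeta values. -/

theorem PadicInt.hasKummerSlope_voronoiSumCoprime {p : ℕ} [hp : Fact p.Prime] (hp2 : p ≠ 2)
    {c : ℕ} (hc : c.Coprime p) {l : ℕ} (hl : l ≠ 0) (m : ℕ) :
    ∃ δ, HasKummerSlope p (fun t => (voronoiSumCoprime p c (l + (p - 1) * t) m : ℤ_[p])) δ := by
  -- By Fermat (cj)^(p-1) ≡ 1 mod p, so each summand is a constant times x^t with x ≡ 1.
  have hterm (j : ℕ) (hj : j ∈ (Finset.range m).filter (fun j => ¬ p ∣ j)) :=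
    (HasKummerSlope.pow (p := p) hp2 (x := ((c * j : ℕ) : ℤ_[p]) ^ (p - 1)) (by
      have hcj : IsCoprime ((c * j : ℕ) : ℤ) p := by
        rw [Nat.isCoprime_iff_coprime]
        exact hc.mul_left ((Nat.Prime.coprime_iff_not_dvd hp.out).2
          (Finset.mem_filter.1 hj).2).symm
      have := (Int.ModEq.pow_card_sub_one_eq_one hp.out hcj).symm.dvd
      exact_mod_cast (Int.castRingHom ℤ_[p]).map_dvd this)).const_mul
      (((c * j / m : ℕ) : ℤ_[p]) * ((c * j : ℕ) : ℤ_[p]) ^ (l - 1))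
  obtain ⟨δ, hδ⟩ : ∃ δ, HasKummerSlope p _ δ := ⟨_, HasKummerSlope.sum _ hterm⟩
  refine ⟨δ, ?_⟩
  convert hδ using 1
  funext t
  rw [voronoiSumCoprime, Nat.cast_sum]
  refine Finset.sum_congr rfl fun j _ => ?_
  rw [show l + (p - 1) * t - 1 = l - 1 + (p - 1) * t by omega, pow_add, pow_mul]
  push_cast
  ring

theorem exists_coprime_not_dvd_pow_sub_one {p : ℕ} [hp : Fact p.Prime] {l : ℕ}
    (hl : ¬ p - 1 ∣ l) : ∃ c : ℕ, c.Coprime p ∧ ¬ (p : ℤ) ∣ (c : ℤ) ^ l - 1 := by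
  have h := mt (FiniteField.forall_pow_eq_one_iff (ZMod p) l).1 (by rwa [ZMod.card])
  push Not at h
  obtain ⟨u, hu⟩ := h
  refine ⟨(u : ZMod p).val, ZMod.val_coe_unit_coprime u, fun hd => hu ?_⟩
  rw [← ZMod.intCast_zmod_eq_zero_iff_dvd] at hd
  push_cast at hd
  rw [ZMod.natCast_zmod_val, sub_eq_zero] at hd
  exact Units.ext (by simpa using hd)

/-- The Kummer congruences, in the form of a first order expansion. -/
theorem exists_hasKummerSlope_zetaWithoutEulerFactor {p : ℕ} [hp : Fact p.Prime] (hp2 : p ≠ 2)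
    {l : ℕ} (hl : ¬ p - 1 ∣ l) :
    ∃ f : ℕ → ℤ_[p], (∀ t, (f t : ℚ_[p]) =
      ((zetaWithoutEulerFactor p (l + (p - 1) * t) : ℚ) : ℚ_[p])) ∧
      HasKummerSlope p f (f 1 - f 0) := by
  have hl0 : l ≠ 0 := by rintro rfl; exact hl (dvd_zero _)
  obtain ⟨c, hc, hcl⟩ := exists_coprime_not_dvd_pow_sub_one hl
  have hlim (t : ℕ) := Padic.tendsto_voronoiSumCoprime hc (n := l + (p - 1) * t) (by omega)
  have hnorm (t : ℕ) := le_of_tendsto' (b := 1) (hlim t).norm fun M =>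
    Padic.norm_int_le_one (p := p) (voronoiSumCoprime p c (l + (p - 1) * t) (p ^ (M + 1)) : ℕ)
  -- `g` is the numerator (1 - cⁿ)ζ_p(1 - n), integral as a limit of integers; `hd` below handles
  -- the denominator 1 - cⁿ.
  let g : ℕ → ℤ_[p] := fun t => ⟨_, hnorm t⟩
  have hg : HasKummerSlope p g (g 1 - g 0) := by
    choose δ hδ using fun M : ℕ =>
      PadicInt.hasKummerSlope_voronoiSumCoprime hp2 hc hl0 (p ^ (M + 1))
    refine HasKummerSlope.of_tendsto hδ fun t => ?_
    refine PadicInt.isOpenEmbedding_coe.isInducing.tendsto_nhds_iff.2 ?_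
    exact hlim t
  have hcp : (p : ℤ_[p]) ∣ (c : ℤ_[p]) ^ (p - 1) - 1 := by
    have := (Int.ModEq.pow_card_sub_one_eq_one hp.out (Nat.isCoprime_iff_coprime.2 hc)).symm.dvd
    exact_mod_cast (Int.castRingHom ℤ_[p]).map_dvd this
  have hd := ((HasKummerSlope.pow hp2 hcp).const_mul (-(c : ℤ_[p]) ^ l)).add
    (HasKummerSlope.const 1)
  -- 1 - cⁿ ≡ 1 - c^l mod p, nonzero by the choice of `c`.
  have hunit (t : ℕ) : IsUnit (-(c : ℤ_[p]) ^ l * ((c : ℤ_[p]) ^ (p - 1)) ^ t + 1) := by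
    rw [← not_not (a := IsUnit _), PadicInt.not_isUnit_iff, PadicInt.norm_lt_one_iff_dvd]
    intro h
    apply hcl
    rw [← PadicInt.norm_intCast_lt_one_iff, PadicInt.norm_lt_one_iff_dvd]
    have h2 := hcp.trans (sub_one_dvd_pow_sub_one ((c : ℤ_[p]) ^ (p - 1)) t)
    push_cast
    have := (h.add (h2.mul_left ((c : ℤ_[p]) ^ l))).neg_right
    convert this using 1
    ring
  choose e he using fun t => (hunit t).exists_right_inv
  have hf := hg.mul (hd.of_mul_eq_one he)
  refine ⟨fun t => g t * e t, fun t => ?_, hf.sub_values⟩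
  have hgt : (g t : ℚ_[p]) = -((c : ℚ_[p]) ^ (l + (p - 1) * t) - 1) *
      ((zetaWithoutEulerFactor p (l + (p - 1) * t) : ℚ) : ℚ_[p]) := rfl
  have het := congrArg (fun x : ℤ_[p] => (x : ℚ_[p])) (he t)
  push_cast at het ⊢
  rw [hgt, pow_add, pow_mul]
  linear_combination ((zetaWithoutEulerFactor p (l + (p - 1) * t) : ℚ) : ℚ_[p]) * het

/-! ### Extension from ℕ to ℤ_p, zeros of isometries, and `p`-adic digits. -/

namespace PadicInt

variable {p : ℕ} [hp : Fact p.Prime]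

theorem neBot_comap_natCast (s : ℤ_[p]) :
    (comap (fun t : ℕ => (t : ℤ_[p])) (𝓝 s)).NeBot := by
  refine comap_neBot fun U hU => ?_
  obtain ⟨_, hx, t, rfl⟩ := mem_closure_iff_nhds.1 (denseRange_natCast s) U hU
  exact ⟨t, hx⟩

theorem exists_tendsto_comap_natCast {f : ℕ → ℤ_[p]}
    (hf : ∀ s t : ℕ, ‖f s - f t‖ ≤ ‖(s : ℤ_[p]) - t‖) (s : ℤ_[p]) :
    ∃ z, Tendsto f (comap (fun t : ℕ => (t : ℤ_[p])) (𝓝 s)) (𝓝 z) := by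
  have := neBot_comap_natCast s
  refine cauchy_map_iff_exists_tendsto.1 ?_
  rw [Metric.cauchy_iff]
  refine ⟨inferInstance, fun ε hε => ?_⟩
  refine ⟨f '' ((fun t : ℕ => (t : ℤ_[p])) ⁻¹' Metric.ball s (ε / 2)),
    image_mem_map (preimage_mem_comap (Metric.ball_mem_nhds s (half_pos hε))), ?_⟩
  rintro _ ⟨a, ha, rfl⟩ _ ⟨b, hb, rfl⟩
  rw [dist_eq_norm]
  refine (hf a b).trans_lt ?_
  rw [← dist_eq_norm]
  have h1 : dist (a : ℤ_[p]) s < ε / 2 := ha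
  have h2 : dist (b : ℤ_[p]) s < ε / 2 := hb
  linarith [dist_triangle_right (a : ℤ_[p]) b s]

/-- An isometry is injective modulo p^N, hence surjective on the finite ring, so it hits 0. -/
theorem exists_pow_dvd_of_norm_sub_eq {g : ℕ → ℤ_[p]}
    (hg : ∀ s t : ℕ, ‖g s - g t‖ = ‖(s : ℤ_[p]) - t‖) (N : ℕ) :
    ∃ t, (p : ℤ_[p]) ^ N ∣ g t := by
  have hinj : Function.Injective fun t : ZMod (p ^ N) => toZModPow N (g t.val) := by
    intro s t hst
    have h : g s.val - g t.val ∈ RingHom.ker (toZModPow (p := p) N) := by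
      rw [RingHom.mem_ker, map_sub, sub_eq_zero]
      exact hst
    rw [ker_toZModPow, Ideal.mem_span_singleton, dvd_iff_norm_le_norm, hg,
      ← dvd_iff_norm_le_norm] at h
    have h2 : (p ^ N : ℤ) ∣ (s.val : ℤ) - t.val := by
      rw [← pow_p_dvd_int_iff]
      exact_mod_cast h
    have h3 := (ZMod.intCast_eq_intCast_iff_dvd_sub (t.val : ℤ) (s.val : ℤ) (p ^ N)).2
      (by exact_mod_cast h2)
    simpa using h3.symm
  obtain ⟨t, ht⟩ := Finite.surjective_of_injective hinj 0
  refine ⟨t.val, ?_⟩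
  rw [← Ideal.mem_span_singleton, ← ker_toZModPow, RingHom.mem_ker]
  exact ht

theorem exists_norm_eq_inv_mul_norm_sub {f : ℕ → ℤ_[p]} (h0 : (p : ℤ_[p]) ∣ f 0)
    (hf : ∀ s t : ℕ, ‖f s - f t‖ = (p : ℝ)⁻¹ * ‖(s : ℤ_[p]) - t‖) :
    ∃ χ : ℤ_[p], ∀ t : ℕ, ‖f t‖ = (p : ℝ)⁻¹ * ‖χ - t‖ := by
  have hp0 : (p : ℝ) ≠ 0 := by exact_mod_cast hp.out.ne_zero
  have hdvd (t : ℕ) : (p : ℤ_[p]) ∣ f t := by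
    have : (p : ℤ_[p]) ∣ f t - f 0 := by
      rw [dvd_iff_norm_le_norm, hf, norm_p]
      exact mul_le_of_le_one_right (by positivity) (norm_le_one _)
    simpa using dvd_add this h0
  choose g hg using hdvd
  have hgn (s t : ℕ) : ‖g s - g t‖ = ‖(s : ℤ_[p]) - t‖ := by
    have := hf s t
    rw [hg s, hg t, ← mul_sub, norm_mul, norm_p] at this
    exact mul_left_cancel₀ (inv_ne_zero hp0) this
  choose t ht using exists_pow_dvd_of_norm_sub_eq hgn
  -- Compactness turns the approximate zeros `t N` into an exact one, χ; the distance from `f s` to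
  -- `f (t (φ N))` then tends to |χ - s|/p.
  obtain ⟨χ, φ, hφ, hχ⟩ := CompactSpace.tendsto_subseq fun N => (t N : ℤ_[p])
  refine ⟨χ, fun s => ?_⟩
  have hzero : Tendsto (fun N => f (t (φ N))) atTop (𝓝 0) := by
    have hpow : Tendsto (fun N : ℕ => ‖(p : ℤ_[p]) ^ N‖) atTop (𝓝 0) := by
      simp only [norm_pow]
      exact tendsto_pow_atTop_nhds_zero_of_lt_one (norm_nonneg _)
        (norm_lt_one_iff_dvd _ |>.2 dvd_rfl)
    refine squeeze_zero_norm (fun N => ?_) (hpow.comp hφ.tendsto_atTop)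
    rw [Function.comp_apply, ← dvd_iff_norm_le_norm, hg]
    exact (ht _).mul_left _
  have h1 := (hzero.sub_const (f s)).norm
  have h2 := ((hχ.sub_const (s : ℤ_[p])).norm).const_mul (p : ℝ)⁻¹
  simp only [hf, zero_sub, norm_neg] at h1
  exact tendsto_nhds_unique h1 h2

theorem digits_unique {χ : ℤ_[p]} {d e : ℕ → ℕ}
    (hd : ∀ n, (∀ j < n, d j < p) ∧
      (p : ℤ_[p]) ^ n ∣ χ - ∑ j ∈ Finset.range n, (d j : ℤ_[p]) * (p : ℤ_[p]) ^ j)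
    (he : ∀ n, (∀ j < n, e j < p) ∧
      (p : ℤ_[p]) ^ n ∣ χ - ∑ j ∈ Finset.range n, (e j : ℤ_[p]) * (p : ℤ_[p]) ^ j) :
    d = e := by
  funext j
  induction j using Nat.strong_induction_on with
  | _ j ih =>
    have h := dvd_sub (he (j + 1)).2 (hd (j + 1)).2
    rw [Finset.sum_range_succ, Finset.sum_range_succ,
      Finset.sum_congr rfl fun i hi => by rw [← ih i (Finset.mem_range.1 hi)]] at h
    obtain ⟨w, hw⟩ := h
    have h2 : (p : ℤ_[p]) ^ 1 ∣ (((d j : ℤ) - (e j : ℤ) : ℤ) : ℤ_[p]) := by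
      refine ⟨w, mul_left_cancel₀ (pow_ne_zero j (prime_p (p := p)).ne_zero) ?_⟩
      push_cast
      linear_combination hw
    rw [pow_p_dvd_int_iff, pow_one] at h2
    have h3 : e j ≡ d j [MOD p] := Int.natCast_modEq_iff.1 (Int.modEq_iff_dvd.2 h2)
    exact (Nat.ModEq.eq_of_lt_of_lt h3 ((he (j + 1)).1 j j.lt_succ_self)
      ((hd (j + 1)).1 j j.lt_succ_self)).symm

theorem existsUnique_digits (χ : ℤ_[p]) :
    ∃! d : ℕ → ℕ, ∀ n, (∀ j < n, d j < p) ∧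
      (p : ℤ_[p]) ^ n ∣ χ - ∑ j ∈ Finset.range n, (d j : ℤ_[p]) * (p : ℤ_[p]) ^ j := by
  have hdig (j : ℕ) : ∃ d, d < p ∧ χ.appr (j + 1) = χ.appr j + p ^ j * d := by
    obtain ⟨d, hd⟩ := χ.dvd_appr_sub_appr j (j + 1) j.le_succ
    have hle := χ.appr_mono (Nat.le_add_right j 1)
    refine ⟨d, ?_, by omega⟩
    have h1 := χ.appr_lt (j + 1)
    rw [pow_succ] at h1
    exact Nat.lt_of_mul_lt_mul_left (a := p ^ j) (by omega)
  choose d hlt hd using hdig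
  have hsum (n : ℕ) : ∑ j ∈ Finset.range n, (d j : ℤ_[p]) * (p : ℤ_[p]) ^ j = χ.appr n := by
    induction n with
    | zero => simp [appr]
    | succ n ih =>
      rw [Finset.sum_range_succ, ih, hd]
      push_cast
      ring
  have key (n : ℕ) : (∀ j < n, d j < p) ∧
      (p : ℤ_[p]) ^ n ∣ χ - ∑ j ∈ Finset.range n, (d j : ℤ_[p]) * (p : ℤ_[p]) ^ j := by
    refine ⟨fun j _ => hlt j, ?_⟩
    rw [hsum, ← Ideal.mem_span_singleton]
    exact χ.appr_spec n
  exact ⟨d, key, fun e he => digits_unique he key⟩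

theorem hasSum_of_pow_dvd {χ : ℤ_[p]} {d : ℕ → ℕ}
    (hd : ∀ n, (p : ℤ_[p]) ^ n ∣ χ - ∑ j ∈ Finset.range n, (d j : ℤ_[p]) * (p : ℤ_[p]) ^ j) :
    HasSum (fun j => (d j : ℤ_[p]) * (p : ℤ_[p]) ^ j) χ := by
  have hlt : ‖(p : ℤ_[p])‖ < 1 := norm_lt_one_iff_dvd _ |>.2 dvd_rfl
  have hs : Summable fun j => (d j : ℤ_[p]) * (p : ℤ_[p]) ^ j := by
    refine Summable.of_norm_bounded (summable_geometric_of_lt_one (norm_nonneg _) hlt) fun j => ?_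
    rw [norm_mul, norm_pow]
    exact mul_le_of_le_one_left (by positivity) (norm_le_one _)
  have h2 : Tendsto (fun n => χ - ∑ j ∈ Finset.range n, (d j : ℤ_[p]) * (p : ℤ_[p]) ^ j)
      atTop (𝓝 0) := by
    refine squeeze_zero_norm (fun n => dvd_iff_norm_le_norm.1 (hd n)) ?_
    simp only [norm_pow]
    exact tendsto_pow_atTop_nhds_zero_of_lt_one (norm_nonneg _) hlt
  have h3 := tendsto_nhds_unique h2 (hs.hasSum.tendsto_sum_nat.const_sub χ)
  rw [eq_comm, sub_eq_zero] at h3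
  rw [h3]
  exact hs.hasSum

end PadicInt

/-! ### Irregular pairs, Δ and the zero χ. -/

/-- The exponent must be positive: `p` dividing the numerator is what keeps it out of the
denominator. -/
theorem Padic.norm_ratCast_le_iff {p : ℕ} [hp : Fact p.Prime] (q : ℚ) (k : ℕ) :
    ((p ^ (k + 1) : ℕ) : ℤ) ∣ q.num ↔ ‖(q : ℚ_[p])‖ ≤ ‖(p : ℤ_[p]) ^ (k + 1)‖ := by
  have hq : (q.num : ℚ_[p]) = q * (q.den : ℚ_[p]) := by
    exact_mod_cast congrArg (fun x : ℚ => (x : ℚ_[p])) (Rat.mul_den_eq_num q).symm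
  have h1 : ((p ^ (k + 1) : ℕ) : ℤ) ∣ q.num ↔ ‖(q.num : ℚ_[p])‖ ≤ ‖(p : ℤ_[p]) ^ (k + 1)‖ := by
    rw [← PadicInt.norm_intCast_eq_padic_norm, ← PadicInt.dvd_iff_norm_le_norm,
      PadicInt.pow_p_dvd_int_iff]
    push_cast
    rfl
  constructor
  · intro h
    have hden : ‖(q.den : ℚ_[p])‖ = 1 := by
      rw [Padic.norm_natCast_eq_one_iff, Nat.Prime.coprime_iff_not_dvd hp.out]
      intro hd
      have hn : p ∣ q.num.natAbs :=
        (dvd_pow_self p k.succ_ne_zero).trans (Int.natCast_dvd.1 h)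
      exact hp.out.one_lt.ne' (Nat.dvd_one.1 (q.reduced ▸ Nat.dvd_gcd hn hd))
    rw [h1, hq, norm_mul, hden, mul_one] at h
    exact h
  · intro h
    rw [h1, hq, norm_mul]
    refine (mul_le_of_le_one_right (norm_nonneg _) ?_).trans h
    exact_mod_cast Padic.norm_int_le_one (p := p) (q.den : ℤ)

theorem norm_zetaWithoutEulerFactor {p : ℕ} [hp : Fact p.Prime] {n : ℕ} (hn : 2 ≤ n) :
    ‖((zetaWithoutEulerFactor p n : ℚ) : ℚ_[p])‖ = ‖((bernoulli n / n : ℚ) : ℚ_[p])‖ := by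
  have hlt : ‖(p : ℚ_[p]) ^ (n - 1)‖ < ‖(1 : ℚ_[p])‖ := by
    rw [norm_pow, norm_one]
    exact pow_lt_one₀ (norm_nonneg _) Padic.norm_p_lt_one (by omega)
  have h1 : ‖1 - (p : ℚ_[p]) ^ (n - 1)‖ = 1 := by
    rw [← norm_neg] at hlt
    rw [sub_eq_add_neg, IsUltrametricDist.norm_add_eq_max_of_norm_ne_norm hlt.ne',
      max_eq_left hlt.le, norm_one]
  have h2 : ((zetaWithoutEulerFactor p n : ℚ) : ℚ_[p]) =
      (1 - (p : ℚ_[p]) ^ (n - 1)) * -((bernoulli n / n : ℚ) : ℚ_[p]) := by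
    simp only [zetaWithoutEulerFactor]
    push_cast
    ring
  rw [h2, norm_mul, h1, one_mul, norm_neg]

theorem IsIrregularPair.bounds {p l : ℕ} (h : IsIrregularPair 1 p l) :
    p.Prime ∧ p ≠ 2 ∧ Even l ∧ 2 ≤ l ∧ l + 3 ≤ p ∧ ¬ p - 1 ∣ l := by
  obtain ⟨hp, ⟨a, ha⟩, h2, hlt, -⟩ := h
  rw [pow_one, Nat.totient_prime hp] at hlt
  have hp2 : p ≠ 2 := by omega
  obtain ⟨b, hb⟩ := hp.odd_of_ne_two hp2
  refine ⟨hp, hp2, ⟨a, ha⟩, h2, by omega, fun hd => ?_⟩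
  have := Nat.le_of_dvd (by omega) hd
  omega

/-- `f` interpolates `t ↦ ζ_p(1 - (l + (p - 1) t))`, and `|f t| = |p (χ - t)|`. -/
structure IsZetaInterpolation (p : ℕ) [Fact p.Prime] (l : ℕ) (f : ℕ → ℤ_[p]) (χ : ℤ_[p]) :
    Prop where
  coe_eq (t : ℕ) : (f t : ℚ_[p]) = ((zetaWithoutEulerFactor p (l + (p - 1) * t) : ℚ) : ℚ_[p])
  norm_eq (t : ℕ) : ‖f t‖ = (p : ℝ)⁻¹ * ‖χ - t‖
  norm_sub_eq (s t : ℕ) : ‖f s - f t‖ = (p : ℝ)⁻¹ * ‖(s : ℤ_[p]) - t‖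

theorem norm_bernoulliDifferenceQuotient_of_irregularDelta_ne_zero {p l : ℕ} [hp : Fact p.Prime]
    (h : irregularDelta 1 p l ≠ 0) :
    1 ≤ ‖((bernoulliDifferenceQuotient 1 p l : ℚ) : ℚ_[p])‖ := by
  by_contra! hlt
  apply h
  have hle : ‖((bernoulliDifferenceQuotient 1 p l : ℚ) : ℚ_[p])‖ ≤ ‖(p : ℤ_[p]) ^ (0 + 1)‖ := by
    have h2 := PadicInt.dvd_iff_norm_le_norm.1 ((PadicInt.norm_lt_one_iff_dvd
      (⟨_, hlt.le⟩ : ℤ_[p])).1 hlt)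
    rw [zero_add, pow_one]
    exact h2
  -- A numerator divisible by `p` makes Δ vanish, whatever the inverse of the denominator.
  rw [← Padic.norm_ratCast_le_iff, zero_add, pow_one, ← ZMod.intCast_zmod_eq_zero_iff_dvd] at hle
  rw [irregularDelta, hle, zero_mul, ZMod.val_zero]

theorem exists_isZetaInterpolation (hΔ : DeltaConjecture) {p : ℕ} [hp : Fact p.Prime] {l : ℕ}
    (hpl : IsIrregularPair 1 p l) : ∃ f χ, IsZetaInterpolation p l f χ := by
  obtain ⟨-, hp2, -, hl2, -, hl⟩ := hpl.bounds
  obtain ⟨f, hf, hs⟩ := exists_hasKummerSlope_zetaWithoutEulerFactor hp2 hl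
  have hp0 : (p : ℚ_[p]) ≠ 0 := by exact_mod_cast hp.out.ne_zero
  have hpinv : (0 : ℝ) < (p : ℝ)⁻¹ := by
    have := hp.out.pos
    positivity
  have hpinv1 : (p : ℝ)⁻¹ < 1 := inv_lt_one_of_one_lt₀ (by exact_mod_cast hp.out.one_lt)
  have hnorm (t : ℕ) : ‖f t‖ =
      ‖((bernoulli (l + (p - 1) * t) / (l + (p - 1) * t : ℕ) : ℚ) : ℚ_[p])‖ := by
    rw [PadicInt.norm_def, hf, norm_zetaWithoutEulerFactor (by omega)]
  have h0 : (p : ℤ_[p]) ∣ f 0 := by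
    have h := (Padic.norm_ratCast_le_iff (bernoulli l / l) 0).1 hpl.2.2.2.2
    rw [PadicInt.dvd_iff_norm_le_norm, hnorm 0]
    simpa using h
  have hdvd (t : ℕ) : ‖f t‖ ≤ (p : ℝ)⁻¹ := by
    rw [← PadicInt.norm_p, ← PadicInt.dvd_iff_norm_le_norm]
    simpa using dvd_add ((Dvd.intro _ rfl).trans (hs.dvd_sub t 0)) h0
  have hdiff : ‖f 1 - f 0‖ = (p : ℝ)⁻¹ := by
    refine le_antisymm ?_ ?_
    · rw [← PadicInt.norm_p, ← PadicInt.dvd_iff_norm_le_norm]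
      exact hs.1
    have hQ := norm_bernoulliDifferenceQuotient_of_irregularDelta_ne_zero (hΔ p l hpl)
    by_contra! hlt
    set b : ℕ → ℚ_[p] := fun t =>
      ((bernoulli (l + (p - 1) * t) / (l + (p - 1) * t : ℕ) : ℚ) : ℚ_[p]) with hb
    have hfb (t : ℕ) : (f t : ℚ_[p]) = -(b t - (p : ℚ_[p]) ^ (l + (p - 1) * t - 1) * b t) := by
      rw [hf]
      simp only [hb, zetaWithoutEulerFactor]
      push_cast
      ring
    -- Δ is defined without Euler factors. The correction is negligible modulo p²: `b t` is already
    -- divisible by `p`, and the exponent of `p` is at least 1.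
    have herr (t : ℕ) : ‖(p : ℚ_[p]) ^ (l + (p - 1) * t - 1) * b t‖ < (p : ℝ)⁻¹ := by
      rw [norm_mul, norm_pow, Padic.norm_p, ← hnorm]
      calc (p : ℝ)⁻¹ ^ (l + (p - 1) * t - 1) * ‖f t‖
          ≤ (p : ℝ)⁻¹ ^ (l + (p - 1) * t - 1) * (p : ℝ)⁻¹ := by gcongr; exact hdvd t
        _ < 1 * (p : ℝ)⁻¹ := by
          gcongr
          exact pow_lt_one₀ hpinv.le hpinv1 (by omega)
        _ = _ := one_mul _
    have hD : ((bernoulliDifferenceQuotient 1 p l : ℚ) : ℚ_[p]) = (b 1 - b 0) / p := by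
      simp only [bernoulliDifferenceQuotient, hb, pow_one, Nat.totient_prime hp.out, mul_one,
        mul_zero, add_zero]
      push_cast
      ring
    rw [hD, norm_div, Padic.norm_p, one_le_div hpinv] at hQ
    have hsplit : b 1 - b 0 = -((f 1 - f 0 : ℤ_[p]) : ℚ_[p]) +
        ((p : ℚ_[p]) ^ (l + (p - 1) * 1 - 1) * b 1 - (p : ℚ_[p]) ^ (l + (p - 1) * 0 - 1) * b 0) := by
      rw [PadicInt.coe_sub, hfb, hfb]
      ring
    refine absurd hQ (not_le.2 ?_)
    rw [hsplit]
    refine (IsUltrametricDist.norm_add_le_max _ _).trans_lt (max_lt ?_ ?_)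
    · rwa [norm_neg, ← PadicInt.norm_def]
    · rw [sub_eq_add_neg]
      refine (IsUltrametricDist.norm_add_le_max _ _).trans_lt (max_lt (herr 1) ?_)
      rw [norm_neg]
      exact herr 0
  have hsub (s t : ℕ) : ‖f s - f t‖ = (p : ℝ)⁻¹ * ‖(s : ℤ_[p]) - t‖ := by
    rcases eq_or_ne s t with rfl | hst
    · simp
    have h := PadicInt.dvd_iff_norm_le_norm.1 (hs.2 s t)
    have hst' : 0 < ‖(s : ℤ_[p]) - t‖ := by
      rw [norm_pos_iff, sub_ne_zero]
      exact_mod_cast hst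
    have hmain : ‖((s : ℤ_[p]) - t) * (f 1 - f 0)‖ = (p : ℝ)⁻¹ * ‖(s : ℤ_[p]) - t‖ := by
      rw [norm_mul, hdiff, mul_comm]
    -- The linear term has norm |s-t|/p, the error at most |s-t|/p²; the ultrametric inequality then
    -- gives equality.
    have hlt : ‖f s - f t - ((s : ℤ_[p]) - t) * (f 1 - f 0)‖ <
        ‖((s : ℤ_[p]) - t) * (f 1 - f 0)‖ := by
      refine h.trans_lt ?_
      rw [hmain, norm_mul, norm_pow, PadicInt.norm_p]
      gcongr
      exact pow_lt_self_of_lt_one₀ hpinv hpinv1 one_lt_two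
    rw [← hmain, ← sub_add_cancel (f s - f t) (((s : ℤ_[p]) - t) * (f 1 - f 0)),
      IsUltrametricDist.norm_add_eq_max_of_norm_ne_norm hlt.ne, max_eq_right hlt.le]
  obtain ⟨χ, hχ⟩ := PadicInt.exists_norm_eq_inv_mul_norm_sub h0 hsub
  exact ⟨f, χ, hf, hχ, hsub⟩

theorem Finset.sum_mul_pow_lt {p : ℕ} (n : ℕ) {d : ℕ → ℕ} (hd : ∀ j < n, d j < p) :
    ∑ j ∈ Finset.range n, d j * p ^ j < p ^ n := by
  induction n with
  | zero => simp
  | succ n ih =>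
    rw [Finset.sum_range_succ]
    have h1 := ih fun j hj => hd j (by omega)
    have h2 : (d n + 1) * p ^ n ≤ p * p ^ n := Nat.mul_le_mul_right _ (hd n n.lt_succ_self)
    rw [pow_succ']
    linarith

/-! ### Digits of irregular pairs are the digits of χ. -/

namespace IsZetaInterpolation

variable {p : ℕ} [hp : Fact p.Prime] {l : ℕ} {f : ℕ → ℤ_[p]} {χ : ℤ_[p]}

theorem pow_dvd_num_iff (hf : IsZetaInterpolation p l f χ) (hl : 2 ≤ l) (n t : ℕ) :
    ((p ^ (n + 1) : ℕ) : ℤ) ∣ (bernoulli (l + (p - 1) * t) / (l + (p - 1) * t : ℕ)).num ↔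
      (p : ℤ_[p]) ^ n ∣ χ - t := by
  have hpinv : (0 : ℝ) < (p : ℝ)⁻¹ := by
    have := hp.out.pos
    positivity
  rw [Padic.norm_ratCast_le_iff, ← norm_zetaWithoutEulerFactor (by omega), ← hf.coe_eq,
    ← PadicInt.norm_def, hf.norm_eq, PadicInt.dvd_iff_norm_le_norm, pow_succ', norm_mul,
    PadicInt.norm_p, mul_le_mul_iff_right₀ hpinv]

theorem isIrregularDigitSequence_iff (hf : IsZetaInterpolation p l f χ)
    (hpl : IsIrregularPair 1 p l) (s : ℕ → ℕ) :
    IsIrregularDigitSequence p l s ↔ s 0 = l ∧ ∀ n, (∀ j < n, s (j + 1) < p) ∧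
      (p : ℤ_[p]) ^ n ∣ χ - ∑ j ∈ Finset.range n, (s (j + 1) : ℤ_[p]) * (p : ℤ_[p]) ^ j := by
  obtain ⟨-, hp2, hle, hl2, hl3, -⟩ := hpl.bounds
  -- Since φ(p⁰) = 1 and φ(p^(j+1)) = (p-1)p^j, the index is l + (p-1)T with `T` a candidate
  -- truncation of χ.
  have hsum (n : ℕ) : ∑ j ∈ Finset.range (n + 1), s j * (p ^ j).totient =
      s 0 + (p - 1) * ∑ j ∈ Finset.range n, s (j + 1) * p ^ j := by
    rw [Finset.sum_range_succ', pow_zero, Nat.totient_one, mul_one, add_comm, Finset.mul_sum]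
    congr 1
    refine Finset.sum_congr rfl fun j _ => ?_
    rw [Nat.totient_prime_pow_succ hp.out]
    ring
  have hcast (n : ℕ) : ∑ j ∈ Finset.range n, (s (j + 1) : ℤ_[p]) * (p : ℤ_[p]) ^ j =
      ((∑ j ∈ Finset.range n, s (j + 1) * p ^ j : ℕ) : ℤ_[p]) := by push_cast; rfl
  rw [IsIrregularDigitSequence]
  refine and_congr_right fun hs0 => ⟨fun h n => ?_, fun h n hn => ?_⟩
  · obtain ⟨-, -, -, hlt, -, -, -, -, hdvd⟩ := h (n + 1) (by omega)
    refine ⟨fun j hj => hlt (j + 1) (by omega), ?_⟩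
    rw [hsum, hs0, hf.pow_dvd_num_iff hl2] at hdvd
    rwa [hcast]
  · obtain ⟨n, rfl⟩ : ∃ k, n = k + 1 := ⟨n - 1, by omega⟩
    obtain ⟨hlt, hdvd⟩ := h n
    refine ⟨hs0 ▸ hle, hs0 ▸ hl2, hs0 ▸ hl3, fun j hj => ?_, hp.out, ?_, ?_, ?_, ?_⟩
    · rcases j with _ | j
      · omega
      · exact hlt j (by omega)
    · rw [hsum, hs0]
      exact hle.add ((hp.out.even_sub_one hp2).mul_right _)
    · rw [hsum]
      omega
    · rw [hsum, hs0, Nat.totient_prime_pow_succ hp.out]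
      -- T ≤ pⁿ - 1 together with l < p - 1 yields l + (p-1)T < φ(p^(n+1)).
      have hT := Finset.sum_mul_pow_lt n hlt
      have h1 : (p - 1) * ((∑ j ∈ Finset.range n, s (j + 1) * p ^ j) + 1) ≤ (p - 1) * p ^ n :=
        Nat.mul_le_mul_left _ hT
      rw [mul_comm (p ^ n)]
      rw [mul_add] at h1
      omega
    · rw [hsum, hs0, hf.pow_dvd_num_iff hl2, ← hcast]
      exact hdvd

theorem existsUnique_isIrregularDigitSequence (hf : IsZetaInterpolation p l f χ)
    (hpl : IsIrregularPair 1 p l) : ∃! s, IsIrregularDigitSequence p l s := by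
  simp only [hf.isIrregularDigitSequence_iff hpl]
  obtain ⟨d, hd, huniq⟩ := PadicInt.existsUnique_digits χ
  refine ⟨fun j => Nat.casesOn j l d, ⟨rfl, hd⟩, fun s ⟨hs0, hs⟩ => ?_⟩
  have := huniq (fun j => s (j + 1)) hs
  funext j
  rcases j with _ | j
  · exact hs0
  · exact congrFun this j

theorem irregularChi_eq (hf : IsZetaInterpolation p l f χ) (hpl : IsIrregularPair 1 p l) :
    irregularChi p l = χ := by
  have h := (hf.existsUnique_isIrregularDigitSequence hpl).exists
  rw [irregularChi, dif_pos h]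
  exact (PadicInt.hasSum_of_pow_dvd fun n =>
    (((hf.isIrregularDigitSequence_iff hpl _).1 h.choose_spec).2 n).2).tsum_eq

theorem hasSum_irregularChi (hf : IsZetaInterpolation p l f χ) (hpl : IsIrregularPair 1 p l)
    {s : ℕ → ℕ} (hs : IsIrregularDigitSequence p l s) :
    HasSum (fun ν : ℕ => (s (ν + 1) : ℤ_[p]) * (p : ℤ_[p]) ^ ν) (irregularChi p l) := by
  rw [hf.irregularChi_eq hpl]
  exact PadicInt.hasSum_of_pow_dvd (d := fun j => s (j + 1)) fun n =>
    (((hf.isIrregularDigitSequence_iff hpl _).1 hs).2 n).2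

/-- The norm identity passes to the limit: |ζ s| = |χ - s|/p, so χ is the only zero. -/
theorem exists_isPadicZeta (hf : IsZetaInterpolation p l f χ) :
    ∃ ζ : ℤ_[p] → ℤ_[p], IsPadicZeta p l ζ ∧ ∀ s, ζ s = 0 ↔ s = χ := by
  have hp0 : (p : ℝ) ≠ 0 := by exact_mod_cast hp.out.ne_zero
  choose ζ hζ using PadicInt.exists_tendsto_comap_natCast (f := f) fun s t => by
    rw [hf.norm_sub_eq]
    exact mul_le_of_le_one_left (norm_nonneg _)
      (inv_le_one_of_one_le₀ (by exact_mod_cast hp.out.one_lt.le))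
  refine ⟨ζ, fun s => ?_, fun s => ?_⟩
  · simp only [← hf.coe_eq]
    exact (PadicInt.isOpenEmbedding_coe.continuous.tendsto (ζ s)).comp (hζ s)
  · have := PadicInt.neBot_comap_natCast s
    have h1 := (hζ s).norm
    simp only [hf.norm_eq] at h1
    have h2 : Tendsto (fun t : ℕ => (p : ℝ)⁻¹ * ‖χ - t‖)
        (comap (fun t : ℕ => (t : ℤ_[p])) (𝓝 s)) (𝓝 ((p : ℝ)⁻¹ * ‖χ - s‖)) :=
      ((tendsto_comap.const_sub χ).norm).const_mul _
    rw [← norm_eq_zero, tendsto_nhds_unique h1 h2, mul_eq_zero, norm_eq_zero, sub_eq_zero]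
    simp [hp0, eq_comm]

end IsZetaInterpolation

/-! ### Sign of B_n and the product formula for ℚ. -/

/-- Euler's evaluation of ζ(2k), a sum of nonnegative terms with a positive one. -/
theorem bernoulli_sign {n : ℕ} (hn : 2 ≤ n) (he : Even n) :
    0 < (-1 : ℝ) ^ (n / 2 - 1) * ((bernoulli n : ℚ) : ℝ) := by
  obtain ⟨k, rfl⟩ := he.two_dvd
  have hk : k ≠ 0 := by omega
  have h := hasSum_zeta_nat hk
  have hpos : 0 < ∑' m : ℕ, 1 / (m : ℝ) ^ (2 * k) :=
    h.summable.tsum_pos (fun m => by positivity) 1 (by simp)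
  rw [h.tsum_eq] at hpos
  rw [Nat.mul_div_cancel_left k two_pos]
  have hsign : (-1 : ℝ) ^ (k + 1) = (-1) ^ (k - 1) := by
    rw [show k + 1 = k - 1 + 2 by omega, pow_add]
    norm_num
  have hfac : 0 < (2 : ℝ) ^ (2 * k - 1) * Real.pi ^ (2 * k) / ((2 * k).factorial : ℝ) := by
    positivity
  rw [hsign] at hpos
  refine (mul_pos_iff_of_pos_right hfac).1 (hpos.trans_eq ?_)
  ring

theorem bernoulli_ne_zero_of_even {n : ℕ} (hn : 2 ≤ n) (he : Even n) : bernoulli n ≠ 0 := by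
  intro h
  have := bernoulli_sign hn he
  simp [h] at this

theorem bernoulli_eq_sign_mul_abs {n : ℕ} (hn : 2 ≤ n) (he : Even n) :
    ((bernoulli n : ℚ) : ℝ) = (-1 : ℝ) ^ (n / 2 - 1) * |((bernoulli n : ℚ) : ℝ)| := by
  have h := bernoulli_sign hn he
  rcases neg_one_pow_eq_or ℝ (n / 2 - 1) with h1 | h1 <;> rw [h1] at h ⊢
  · rw [abs_of_pos (by linarith), one_mul]
  · rw [abs_of_neg (by linarith)]
    ring

theorem Nat.Primes.finite_dvd {m : ℕ} (hm : m ≠ 0) : {p : Nat.Primes | (p : ℕ) ∣ m}.Finite :=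
  Set.Finite.preimage (s := {k : ℕ | k ∣ m}) Nat.Primes.coe_nat_injective.injOn
    ((Set.finite_le_nat m).subset fun _ h => Nat.le_of_dvd (Nat.pos_of_ne_zero hm) h)

theorem Nat.norm_padic_inv_ne_one_iff (p : Nat.Primes) (m : ℕ) :
    ‖(m : ℚ_[(p : ℕ)])‖⁻¹ ≠ 1 ↔ (p : ℕ) ∣ m := by
  rw [Ne, inv_eq_one, Padic.norm_natCast_eq_one_iff, Nat.Prime.coprime_iff_not_dvd p.2, not_not]

theorem Nat.finite_mulSupport_norm_padic_inv {m : ℕ} (hm : m ≠ 0) :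
    (Function.mulSupport fun p : Nat.Primes => ‖(m : ℚ_[(p : ℕ)])‖⁻¹).Finite :=
  (Nat.Primes.finite_dvd hm).subset fun p hp => (Nat.norm_padic_inv_ne_one_iff p m).1 hp

theorem Nat.finprod_norm_padic_inv {m : ℕ} (hm : m ≠ 0) :
    ∏ᶠ p : Nat.Primes, ‖(m : ℚ_[(p : ℕ)])‖⁻¹ = m := by
  induction m using Nat.recOnMul with
  | zero => exact absurd rfl hm
  | one => simp
  | prime q hq =>
    obtain ⟨Q, rfl⟩ : ∃ Q : Nat.Primes, (Q : ℕ) = q := ⟨⟨q, hq⟩, rfl⟩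
    rw [finprod_eq_single _ Q]
    · rw [Padic.norm_p, inv_inv]
    · intro p hp
      by_contra h
      rw [← Ne, Nat.norm_padic_inv_ne_one_iff, Nat.prime_dvd_prime_iff_eq p.2 hq] at h
      exact hp (Subtype.ext h)
  | mul a b iha ihb =>
    have ha : a ≠ 0 := left_ne_zero_of_mul hm
    have hb : b ≠ 0 := right_ne_zero_of_mul hm
    simp only [Nat.cast_mul, norm_mul, mul_inv]
    rw [finprod_mul_distrib (Nat.finite_mulSupport_norm_padic_inv ha)
      (Nat.finite_mulSupport_norm_padic_inv hb), iha ha, ihb hb]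

theorem Rat.abs_eq_finprod_norm_padic_inv {q : ℚ} (hq : q ≠ 0) :
    |(q : ℝ)| = ∏ᶠ p : Nat.Primes, ‖(q : ℚ_[(p : ℕ)])‖⁻¹ := by
  have hnum : q.num.natAbs ≠ 0 := Int.natAbs_ne_zero.2 (Rat.num_ne_zero.2 hq)
  have h (p : Nat.Primes) : ‖(q : ℚ_[(p : ℕ)])‖⁻¹ =
      ‖(q.num.natAbs : ℚ_[(p : ℕ)])‖⁻¹ / ‖(q.den : ℚ_[(p : ℕ)])‖⁻¹ := by
    have h1 : ‖(q.num.natAbs : ℚ_[(p : ℕ)])‖ = ‖(q.num : ℚ_[(p : ℕ)])‖ := by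
      rcases Int.natAbs_eq q.num with h | h <;> nth_rewrite 2 [h] <;> push_cast <;> simp
    rw [h1, Rat.cast_def, norm_div, inv_div, inv_div_inv]
  simp only [h]
  rw [finprod_div_distrib (Nat.finite_mulSupport_norm_padic_inv hnum)
    (Nat.finite_mulSupport_norm_padic_inv q.den_ne_zero), Nat.finprod_norm_padic_inv hnum,
    Nat.finprod_norm_padic_inv q.den_ne_zero, Nat.cast_natAbs, Int.cast_abs, Rat.cast_def, abs_div,
    Nat.abs_cast]

/-! ### Local factors of B_n and their product. -/

/-- By von Staudt–Clausen, B_n is -1/p plus a `p`-integral number. -/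
theorem norm_bernoulli_of_sub_one_dvd {p n : ℕ} [hp : Fact p.Prime] (hn : 2 ≤ n) (he : Even n)
    (hd : p - 1 ∣ n) : ‖((bernoulli n : ℚ) : ℚ_[p])‖ = p := by
  obtain ⟨k, rfl⟩ := he.two_dvd
  obtain ⟨z, hz⟩ := Bernoulli.vonStaudt_clausen k
  have hmem : p ∈ (Finset.range (2 * k + 2)).filter fun q => q.Prime ∧ q - 1 ∣ 2 * k := by
    have := Nat.le_of_dvd (by omega) hd
    simp only [Finset.mem_filter, Finset.mem_range]
    exact ⟨by omega, hp.out, hd⟩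
  rw [← Finset.add_sum_erase _ _ hmem] at hz
  set R := ((Finset.range (2 * k + 2)).filter fun q => q.Prime ∧ q - 1 ∣ 2 * k).erase p with hR
  have hsum : ‖∑ q ∈ R, (1 / q : ℚ_[p])‖ ≤ 1 := by
    refine IsUltrametricDist.norm_sum_le_of_forall_le_of_nonneg zero_le_one fun q hq => ?_
    simp only [hR, Finset.mem_erase, Finset.mem_filter] at hq
    have : ‖(q : ℚ_[p])‖ = 1 := by
      rw [Padic.norm_natCast_eq_one_iff, Nat.coprime_primes hp.out hq.2.2.1]
      exact hq.1.symm
    rw [norm_div, this]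
    simp
  have hB : ((bernoulli (2 * k) : ℚ) : ℚ_[p]) = -(p : ℚ_[p])⁻¹ + (z - ∑ q ∈ R, (1 / q : ℚ_[p])) := by
    have := congrArg (fun x : ℚ => (x : ℚ_[p])) hz
    push_cast at this
    simp only [one_div] at this ⊢
    linear_combination -this
  have h1 : ‖-(p : ℚ_[p])⁻¹‖ = p := by rw [norm_neg, norm_inv, Padic.norm_p, inv_inv]
  have h2 : ‖(z : ℚ_[p]) - ∑ q ∈ R, (1 / q : ℚ_[p])‖ < ‖-(p : ℚ_[p])⁻¹‖ := by
    rw [h1]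
    refine lt_of_le_of_lt ?_ (by exact_mod_cast hp.out.one_lt : (1 : ℝ) < p)
    rw [sub_eq_add_neg]
    refine (IsUltrametricDist.norm_add_le_max _ _).trans (max_le (Padic.norm_int_le_one z) ?_)
    rwa [norm_neg]
  rw [hB, IsUltrametricDist.norm_add_eq_max_of_norm_ne_norm h2.ne', max_eq_left h2.le, h1]

/-- All zeta values in the class of `l` agree modulo `p`; one nonunit would force `p` to divide
B_l/l. -/
theorem norm_bernoulli_div_of_not_isIrregularPair {p l : ℕ} [hp : Fact p.Prime] (he : Even l)
    (h2 : 2 ≤ l) (hlt : l < p - 1) (h : ¬ IsIrregularPair 1 p l) (t : ℕ) :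
    ‖((bernoulli (l + (p - 1) * t) / (l + (p - 1) * t : ℕ) : ℚ) : ℚ_[p])‖ = 1 := by
  have hl : ¬ p - 1 ∣ l := fun hd => by
    have := Nat.le_of_dvd (by omega) hd
    omega
  obtain ⟨f, hf, hs⟩ := exists_hasKummerSlope_zetaWithoutEulerFactor (p := p) (by omega) hl
  have hnorm (t : ℕ) : ‖f t‖ =
      ‖((bernoulli (l + (p - 1) * t) / (l + (p - 1) * t : ℕ) : ℚ) : ℚ_[p])‖ := by
    rw [PadicInt.norm_def, hf, norm_zetaWithoutEulerFactor (by omega)]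
  rw [← hnorm]
  refine le_antisymm (PadicInt.norm_le_one _) (not_lt.1 fun hlt1 => h ⟨hp.out, he, h2, ?_, ?_⟩)
  · rwa [pow_one, Nat.totient_prime hp.out]
  · rw [PadicInt.norm_lt_one_iff_dvd] at hlt1
    have h0 := dvd_sub hlt1 ((Dvd.intro _ rfl).trans (hs.dvd_sub t 0))
    rw [sub_sub_cancel, PadicInt.dvd_iff_norm_le_norm, hnorm 0] at h0
    have := Padic.norm_ratCast_le_iff (p := p) (bernoulli l / l) 0
    rw [zero_add] at this
    rw [this]
    simpa using h0

theorem injOn_fst_irregularPairsAt (n : ℕ) : Set.InjOn Prod.fst (irregularPairsAt n) := by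
  rintro ⟨p, l⟩ ⟨h1, h2⟩ ⟨q, l'⟩ ⟨h3, h4⟩ (rfl : p = q)
  have b1 := h1.bounds
  have b2 := h3.bounds
  dsimp only at h2 h4 b1 b2
  rw [(h2.symm.trans h4).eq_of_lt_of_lt (by omega) (by omega)]

theorem Nat.Primes.finite_sub_one_dvd {n : ℕ} (hn : n ≠ 0) :
    {p : Nat.Primes | (p : ℕ) - 1 ∣ n}.Finite :=
  Set.Finite.preimage (s := {k : ℕ | k - 1 ∣ n}) Nat.Primes.coe_nat_injective.injOn
    ((Set.finite_le_nat (n + 1)).subset fun k hk => by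
      have : k - 1 ≤ n := Nat.le_of_dvd (Nat.pos_of_ne_zero hn) hk
      exact Nat.le_add_of_sub_le this)

theorem finite_irregularPairsAt {n : ℕ} (hn : 2 ≤ n) (he : Even n) :
    (irregularPairsAt n).Finite := by
  refine Set.Finite.of_finite_image ?_ (injOn_fst_irregularPairsAt n)
  have hnum : (bernoulli n / n).num.natAbs ≠ 0 := by
    rw [Int.natAbs_ne_zero, Rat.num_ne_zero]
    exact div_ne_zero (bernoulli_ne_zero_of_even hn he) (by exact_mod_cast (by omega : n ≠ 0))
  have h1 : {p : Nat.Primes | (p : ℕ) ≤ n + 1}.Finite :=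
    Set.Finite.preimage (s := {k : ℕ | k ≤ n + 1}) Nat.Primes.coe_nat_injective.injOn
      (Set.finite_le_nat (n + 1))
  refine (h1.union (Nat.Primes.finite_dvd hnum)).subset ?_
  rintro _ ⟨⟨p, l⟩, ⟨hirr, hmod⟩, rfl⟩
  by_cases hp : (p : ℕ) ≤ n + 1
  · exact Or.inl hp
  · have b := hirr.bounds
    dsimp only at b hmod hirr
    -- For p > n + 1 the pair must be (p, n), so `p` divides the nonzero numerator of B_n/n.
    obtain rfl : n = l := hmod.eq_of_lt_of_lt (by omega) (by omega)
    have hdvd := hirr.2.2.2.2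
    rw [pow_one] at hdvd
    exact Or.inr (Int.natCast_dvd.1 hdvd)

/-- The factor of `|B_n|` at an irregular pair `(p, l)`. -/
noncomputable def irregularFactor (n : ℕ) (p : ℕ) [Fact p.Prime] (l : ℕ) : ℝ :=
  ‖(p : ℚ_[p]) * ((irregularChi p l : ℚ_[p]) -
    ((n : ℚ_[p]) - (l : ℚ_[p])) / ((p : ℚ_[p]) - 1))‖⁻¹

theorem norm_bernoulli_div_of_isIrregularPair (hΔ : DeltaConjecture) {p l : ℕ}
    [hp : Fact p.Prime] (hpl : IsIrregularPair 1 p l) (t : ℕ) :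
    ‖((bernoulli (l + (p - 1) * t) / (l + (p - 1) * t : ℕ) : ℚ) : ℚ_[p])‖⁻¹ =
      irregularFactor (l + (p - 1) * t) p l := by
  obtain ⟨f, χ, hf⟩ := exists_isZetaInterpolation hΔ hpl
  obtain ⟨-, -, -, hl2, -, -⟩ := hpl.bounds
  have hp1 : (p : ℚ_[p]) - 1 ≠ 0 := by
    rw [sub_ne_zero]
    exact_mod_cast hp.out.ne_one
  have ht : (((l + (p - 1) * t : ℕ) : ℚ_[p]) - (l : ℚ_[p])) / ((p : ℚ_[p]) - 1) = t := by
    rw [div_eq_iff hp1]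
    push_cast [Nat.cast_sub hp.out.one_lt.le]
    ring
  rw [irregularFactor, ht, hf.irregularChi_eq hpl, ← norm_zetaWithoutEulerFactor (by omega),
    ← hf.coe_eq, ← PadicInt.norm_def, hf.norm_eq, norm_mul, Padic.norm_p]
  congr 2

/-- The second product is indexed by primes here, with l = n mod (p-1), so that all three can be
merged prime by prime. -/
theorem norm_bernoulli_inv (hΔ : DeltaConjecture) {n : ℕ} (hn : 2 ≤ n) (he : Even n)
    (p : Nat.Primes) :
    ‖((bernoulli n : ℚ) : ℚ_[(p : ℕ)])‖⁻¹ =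
      Set.mulIndicator {p : Nat.Primes | ¬ (p : ℕ) - 1 ∣ n}
          (fun p => ‖(n : ℚ_[(p : ℕ)])‖⁻¹) p *
        Set.mulIndicator (Prod.fst '' irregularPairsAt n)
          (fun p => irregularFactor n p (n % ((p : ℕ) - 1))) p *
        Set.mulIndicator {p : Nat.Primes | (p : ℕ) - 1 ∣ n} (fun p => ((p : ℕ) : ℝ)⁻¹) p := by
  classical
  have hp := p.2
  have hmem : p ∈ Prod.fst '' irregularPairsAt n ↔ IsIrregularPair 1 p (n % ((p : ℕ) - 1)) := by
    constructor
    · rintro ⟨⟨q, l⟩, ⟨h1, h2⟩, rfl⟩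
      have b := h1.bounds
      dsimp only at h1 h2 b ⊢
      rwa [h2, Nat.mod_eq_of_lt (by omega)]
    · exact fun h => ⟨(p, _), ⟨h, (Nat.mod_modEq _ _).symm⟩, rfl⟩
  simp only [Set.mulIndicator_apply, hmem, Set.mem_ofPred_eq]
  by_cases hd : (p : ℕ) - 1 ∣ n
  · have hirr : ¬ IsIrregularPair 1 p (n % ((p : ℕ) - 1)) := fun h => by
      have b := h.bounds
      rw [Nat.mod_eq_zero_of_dvd hd] at b
      omega
    rw [if_neg (not_not.2 hd), if_neg hirr, if_pos hd, norm_bernoulli_of_sub_one_dvd hn he hd,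
      one_mul, one_mul]
  · rw [if_pos hd, if_neg hd, mul_one]
    have hsplit : ‖((bernoulli n : ℚ) : ℚ_[(p : ℕ)])‖⁻¹ = ‖(n : ℚ_[(p : ℕ)])‖⁻¹ *
        ‖((bernoulli n / n : ℚ) : ℚ_[(p : ℕ)])‖⁻¹ := by
      have hn0 : (n : ℚ_[(p : ℕ)]) ≠ 0 := by exact_mod_cast (by omega : n ≠ 0)
      rw [← mul_inv, ← norm_mul]
      push_cast
      rw [mul_div_cancel₀ _ hn0]
    rw [hsplit]
    congr 1
    have hdiv := Nat.mod_add_div n ((p : ℕ) - 1)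
    have hp2 : (p : ℕ) ≠ 2 := fun h => hd (by rw [h]; exact one_dvd n)
    have hodd := hp.even_sub_one hp2
    set l := n % ((p : ℕ) - 1) with hl
    set t := n / ((p : ℕ) - 1)
    have hl0 : l ≠ 0 := fun h => hd (Nat.dvd_of_mod_eq_zero h)
    have hle : Even l := (Nat.even_add.1 (hdiv ▸ he)).2 (hodd.mul_right _)
    have hlt : l < (p : ℕ) - 1 := Nat.mod_lt _ (by have := hp.two_le; omega)
    have hl2 : 2 ≤ l := by
      obtain ⟨a, ha⟩ := hle
      omega
    clear_value l t
    subst hdiv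
    split_ifs with hirr
    · exact norm_bernoulli_div_of_isIrregularPair hΔ hirr t
    · rw [norm_bernoulli_div_of_not_isIrregularPair hle hl2 hlt hirr, inv_one]

theorem finprod_irregularFactor (n : ℕ) :
    ∏ᶠ p ∈ Prod.fst '' irregularPairsAt n, irregularFactor n p (n % ((p : ℕ) - 1)) =
      ∏ᶠ x ∈ irregularPairsAt n, irregularFactor n x.1 x.2 := by
  rw [finprod_mem_image (injOn_fst_irregularPairsAt n)]
  refine finprod_mem_congr rfl fun x hx => ?_
  have b := hx.1.bounds
  rw [hx.2, Nat.mod_eq_of_lt (by omega)]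

theorem bernoulli_eq_finprod (hΔ : DeltaConjecture) {n : ℕ} (hn : 2 ≤ n) (he : Even n) :
    ((bernoulli n : ℚ) : ℝ) =
      (-1 : ℝ) ^ (n / 2 - 1)
        * (∏ᶠ p ∈ {p : Nat.Primes | ¬ (p : ℕ) - 1 ∣ n}, ‖(n : ℚ_[(p : ℕ)])‖⁻¹)
        * (∏ᶠ x ∈ irregularPairsAt n, irregularFactor n x.1 x.2)
        * ∏ᶠ p ∈ {p : Nat.Primes | (p : ℕ) - 1 ∣ n}, ((p : ℕ) : ℝ)⁻¹ := by
  have hn0 : n ≠ 0 := by omega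
  -- `finprod` is 1 by default on infinite support, so splitting the product requires finiteness.
  have hA : (Function.mulSupport (Set.mulIndicator {p : Nat.Primes | ¬ (p : ℕ) - 1 ∣ n}
      fun p => ‖(n : ℚ_[(p : ℕ)])‖⁻¹)).Finite := by
    rw [Set.mulSupport_mulIndicator]
    exact (Nat.finite_mulSupport_norm_padic_inv hn0).inter_of_right _
  have hB := ((finite_irregularPairsAt hn he).image Prod.fst).subset
    (Set.mulSupport_mulIndicator_subset
      (f := fun p : Nat.Primes => irregularFactor n p (n % ((p : ℕ) - 1))))
  have hC := (Nat.Primes.finite_sub_one_dvd hn0).subset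
    (Set.mulSupport_mulIndicator_subset (f := fun p : Nat.Primes => ((p : ℕ) : ℝ)⁻¹))
  rw [bernoulli_eq_sign_mul_abs hn he,
    Rat.abs_eq_finprod_norm_padic_inv (bernoulli_ne_zero_of_even hn he),
    ← finprod_irregularFactor, finprod_mem_def, finprod_mem_def, finprod_mem_def, mul_assoc,
    mul_assoc, ← finprod_mul_distrib hB hC, ← finprod_mul_distrib hA]
  · congr 1
    refine finprod_congr fun p => ?_
    rw [norm_bernoulli_inv hΔ hn he, mul_assoc]
  · exact Function.HasFiniteMulSupport.mul hB hC

theorem mainTheorem2 (hΔ : DeltaConjecture) :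
    -- the characteristic `p`-adic integers are well defined, and are the zeros of `ζ_{p,l}`
    (∀ (p : Nat.Primes) (l : ℕ), IsIrregularPair 1 p l →
      (∃! s : ℕ → ℕ, IsIrregularDigitSequence p l s) ∧
      (∀ s : ℕ → ℕ, IsIrregularDigitSequence p l s →
        HasSum (fun ν : ℕ => (s (ν + 1) : ℤ_[(p : ℕ)]) * ((p : ℕ) : ℤ_[(p : ℕ)]) ^ ν)
          (irregularChi p l)) ∧
      (∃ ζ : ℤ_[(p : ℕ)] → ℤ_[(p : ℕ)], IsPadicZeta p l ζ ∧
        ∀ s : ℤ_[(p : ℕ)], ζ s = 0 ↔ s = irregularChi p l)) ∧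
    ∀ n : ℕ, 2 ≤ n → Even n →
      -- all but finitely many factors of the three products are trivial
      {p : Nat.Primes | ¬ ((p : ℕ) - 1 ∣ n) ∧ ‖(n : ℚ_[(p : ℕ)])‖⁻¹ ≠ 1}.Finite ∧
      (irregularPairsAt n).Finite ∧
      {p : Nat.Primes | (p : ℕ) - 1 ∣ n}.Finite ∧
      -- the product formula
      ((bernoulli n : ℚ) : ℝ) =
        (-1 : ℝ) ^ (n / 2 - 1)
          * (∏ᶠ (p : Nat.Primes) (_ : ¬ ((p : ℕ) - 1 ∣ n)), ‖(n : ℚ_[(p : ℕ)])‖⁻¹)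
          * (∏ᶠ (x : Nat.Primes × ℕ) (_ : x ∈ irregularPairsAt n),
              ‖((x.1 : ℕ) : ℚ_[(x.1 : ℕ)]) *
                ((irregularChi x.1 x.2 : ℚ_[(x.1 : ℕ)]) -
                  ((n : ℚ_[(x.1 : ℕ)]) - (x.2 : ℚ_[(x.1 : ℕ)])) /
                    (((x.1 : ℕ) : ℚ_[(x.1 : ℕ)]) - 1))‖⁻¹)
          * ∏ᶠ (p : Nat.Primes) (_ : (p : ℕ) - 1 ∣ n), ((p : ℕ) : ℝ)⁻¹ := by
  refine ⟨fun p l hpl => ?_, fun n hn he => ⟨?_, finite_irregularPairsAt hn he,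
    Nat.Primes.finite_sub_one_dvd (by omega), bernoulli_eq_finprod hΔ hn he⟩⟩
  · obtain ⟨f, χ, hf⟩ := exists_isZetaInterpolation hΔ hpl
    refine ⟨hf.existsUnique_isIrregularDigitSequence hpl,
      fun s hs => hf.hasSum_irregularChi hpl hs, ?_⟩
    rw [hf.irregularChi_eq hpl]
    exact hf.exists_isPadicZeta
  · exact (Nat.Primes.finite_dvd (by omega : n ≠ 0)).subset fun p hp =>
      (Nat.norm_padic_inv_ne_one_iff p n).1 hp.2
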